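/- Let $k$ and $f$ be positive integers with $\gcd(k,2f+1)=1$, let $q=2^{2f+1}$, and let $\gamma$ be a primitive element of $\mathbb{F}_q$, i.e. a generator of $\mathbb{F}_q^*$. For an integer $t\ge 0$ let $g_t(x)\in\mathbb{F}_2[x]$ be the minimal polynomial of $\gamma^t$ over $\mathbb{F}_2$. Let $C_{1,2^k+1}$ be the binary cyclic code of length $n=q-1$ with generator polynomial $g_1(x)\,g_{2^k+1}(x)$, that is, the set of words $(c_0,\dots,c_{n-1})\in\mathbb{F}_2^n$ for which the class of $c_0+c_1x+\cdots+c_{n-1}x^{n-1}$ lies in the ideal generated by $g_1(x)\,g_{2^k+1}(x)$ in $\mathbb{F}_2[x]/(x^n-1)$. Let $A_w$ denote the number of codewords of $C_{1,2^k+1}$ of Hamming weight $w$. Then $$A_3=0,\qquad A_4=0,\qquad A_5=\frac{(q-1)(q-2)(q-8)}{120},\qquad A_6=\frac{(q-1)(q-2)(q-6)(q-8)}{720}.$$ -/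

import Mathlib

open Polynomial

namespace CyclicCode

noncomputable section

/-- The polynomial form `c(x) = c₀ + c₁ x + ⋯ + c_{n-1} x^{n-1}` of a word `c` of length `n`. -/
def wordPoly (K : Type*) [Field K] (n : ℕ) : (Fin n → K) →ₗ[K] K[X] :=
  ∑ i : Fin n, (Polynomial.monomial (i : ℕ)) ∘ₗ (LinearMap.proj i)

/-- The cyclic code of length `n` over `K` generated by the polynomial `g`: the words `c` whose
polynomial form lies in the ideal generated by `g` in `K[x] / (x ^ n - 1)`. -/
def ofGenerator {K : Type*} [Field K] (n : ℕ) (g : K[X]) : Submodule K (Fin n → K) :=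
  ((Ideal.span {Ideal.Quotient.mk (Ideal.span {(X ^ n - 1 : K[X])}) g}).restrictScalars K).comap
    ((Ideal.Quotient.mkₐ K (Ideal.span {(X ^ n - 1 : K[X])})).toLinearMap ∘ₗ wordPoly K n)

/-- The code `C_{t_1, …, t_s}` over `𝔽_p`: the cyclic code of length `|F| - 1` whose generator
polynomial is `∏ j, g_{t_j}(x)`, with `g_t` the minimal polynomial of `γ ^ t` over `𝔽_p`. -/
def code (p : ℕ) [Fact p.Prime] {F : Type*} [Field F] [Algebra (ZMod p) F] (γ : F)
    {s : ℕ} (t : Fin s → ℕ) : Submodule (ZMod p) (Fin (Nat.card F - 1) → ZMod p) :=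
  ofGenerator (Nat.card F - 1) (∏ j, minpoly (ZMod p) (γ ^ t j))

/-- `A_w`: the number of codewords of Hamming weight `w`. -/
def weightCount {p n : ℕ} (C : Submodule (ZMod p) (Fin n → ZMod p)) (w : ℕ) : ℕ :=
  {c : Fin n → ZMod p | c ∈ C ∧ hammingNorm c = w}.ncard

end

end CyclicCode

/-! A codeword of weight `w` is a `w`-subset `S` of `F \ {0}` with `∑ x = 0` and `∑ x ^ (2 ^ k + 1)
= 0` (`weightCount_code`); sets containing 0 are allowed as an auxiliary. The map `x ↦ x ^ (2 ^ k +
1)` is quadratic over `𝔽₂` with polar form `u ^ 2 ^ k * v + u * v ^ 2 ^ k`. As `k` is prime to `m =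
2f + 1`, this form vanishes only if `u = 0`, `v = 0` or `u = v`, which rules out zero-sum 4-sets
and, after adjoining 0, 3-sets avoiding 0. As `m` is odd, the power map is also bijective, so the
form takes each nonzero value `q - 2` times. Hence for each 3-set `T`, `q - 2` ordered triples share
its two sums. Six are orderings of `T` and the rest are disjoint from it, so `T` lies in `(q - 8) /
6` zero-sum 6-sets. Double counting gives their number `N`. Translations preserve zero-sum 6-sets,
so `6 N = q A₅`, since the 6-sets through 0 correspond to 5-sets avoiding it. Finally `A₆ = N - A₅`.
-/

namespace CyclicCode

/-! ### The quadratic map `x ^ (2 ^ k + 1)` and its polar form. -/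

section ZeroSum

variable {F : Type*} [Field F]

theorem pow_two_pow_eq_self_iff [Finite F] [CharP F 2] {j m : ℕ} (hF : Nat.card F = 2 ^ m)
    (hjm : Nat.gcd j m = 1) {x : F} : x ^ 2 ^ j = x ↔ x = 0 ∨ x = 1 := by
  refine ⟨fun h => ?_, ?_⟩
  · have := Fintype.ofFinite F
    have hj : Function.IsPeriodicPt (frobenius F 2) j x := by
      simpa [Function.IsPeriodicPt, Function.IsFixedPt, iterate_frobenius] using h
    have hm : Function.IsPeriodicPt (frobenius F 2) m x := by
      have := FiniteField.pow_card x
      rw [← Nat.card_eq_fintype_card, hF] at this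
      simpa [Function.IsPeriodicPt, Function.IsFixedPt, iterate_frobenius] using this
    have h1 := hj.gcd hm
    rw [hjm] at h1
    have h2 : x ^ 2 = x := by
      simpa [Function.IsPeriodicPt, Function.IsFixedPt, frobenius_def] using h1
    have h3 : x * (x - 1) = 0 := by linear_combination h2
    rcases mul_eq_zero.1 h3 with h | h
    · exact Or.inl h
    · exact Or.inr (sub_eq_zero.1 h)
  · rintro (rfl | rfl) <;> simp

/-- A ratio `r` of two elements with equal image satisfies `r ^ 2 ^ k = r⁻¹`, so it is fixed by the
`2k`-th Frobenius iterate; odd `m` keeps `2k` prime to `m`. -/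
theorem pow_two_pow_add_one_injective [Finite F] [CharP F 2] {k m : ℕ}
    (hF : Nat.card F = 2 ^ m) (hkm : Nat.gcd k m = 1) (hm : Odd m) :
    Function.Injective fun x : F => x ^ (2 ^ k + 1) := by
  have hgcd : Nat.gcd (k * 2) m = 1 :=
    Nat.Coprime.mul_left hkm (Nat.coprime_two_left.2 hm)
  intro x y hxy
  simp only at hxy
  by_cases hy : y = 0
  · subst hy
    simpa using hxy
  have hr : (x / y) ^ 2 ^ k * (x / y) = 1 := by
    rw [← pow_succ, div_pow, hxy, div_self (pow_ne_zero _ hy)]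
  have hr0 : x / y ≠ 0 := right_ne_zero_of_mul_eq_one hr
  have hr1 : (x / y) ^ 2 ^ k = (x / y)⁻¹ := eq_inv_of_mul_eq_one_left hr
  have hr2 : (x / y) ^ 2 ^ (k * 2) = x / y := by
    rw [mul_two, pow_add, pow_mul, hr1, inv_pow, hr1, inv_inv]
  rcases (pow_two_pow_eq_self_iff hF hgcd).1 hr2 with h | h
  · exact absurd h hr0
  · exact (div_eq_one_iff_eq hy).1 h

theorem add_pow_two_pow_add_one [CharP F 2] (k : ℕ) (x y : F) :
    (x + y) ^ (2 ^ k + 1) =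
      x ^ (2 ^ k + 1) + y ^ (2 ^ k + 1) + (x ^ 2 ^ k * y + x * y ^ 2 ^ k) := by
  rw [pow_succ, add_pow_char_pow]
  ring

theorem polar_eq_zero_iff [CharP F 2] {k : ℕ} (hfix : ∀ x : F, x ^ 2 ^ k = x ↔ x = 0 ∨ x = 1)
    {u v : F} : u ^ 2 ^ k * v + u * v ^ 2 ^ k = 0 ↔ u = 0 ∨ v = 0 ∨ u = v := by
  refine ⟨fun h => ?_, ?_⟩
  · by_cases hv : v = 0
    · exact Or.inr (Or.inl hv)
    have h1 : (u / v) ^ 2 ^ k = u / v := by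
      rw [div_pow, div_eq_div_iff (pow_ne_zero _ hv) hv]
      exact CharTwo.add_eq_zero.1 h
    rcases (hfix _).1 h1 with h | h
    · exact Or.inl (by simpa [hv] using h)
    · exact Or.inr (Or.inr ((div_eq_one_iff_eq hv).1 h))
  · rintro (rfl | rfl | rfl)
    · simp
    · simp
    · rw [← pow_succ, ← pow_succ', CharTwo.add_self_eq_zero]

/-- Four elements with vanishing sum and vanishing power sum of exponent `2 ^ k + 1` are not
distinct. -/
theorem eq_of_two_power_sums_eq [CharP F 2] {k : ℕ}
    (hfix : ∀ x : F, x ^ 2 ^ k = x ↔ x = 0 ∨ x = 1) {x y z w : F} (h1 : x + y + z + w = 0)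
    (h2 : x ^ (2 ^ k + 1) + y ^ (2 ^ k + 1) + z ^ (2 ^ k + 1) + w ^ (2 ^ k + 1) = 0) :
    x = y ∨ x = z ∨ x = w := by
  -- Eliminating `w = x + y + z` turns `h2` into the vanishing of the polar form at `(x + y, x +
  -- z)`.
  have hB : (x + y) ^ 2 ^ k * (x + z) + (x + y) * (x + z) ^ 2 ^ k = 0 := by
    have hw : w = x + y + z := (CharTwo.add_eq_zero.1 h1).symm
    rw [hw, pow_succ, pow_succ, pow_succ, pow_succ, add_pow_char_pow, add_pow_char_pow] at h2
    rw [add_pow_char_pow, add_pow_char_pow]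
    linear_combination h2 + (-y ^ 2 ^ k * y - z ^ 2 ^ k * z) * CharTwo.two_eq_zero (R := F)
  rcases (polar_eq_zero_iff hfix).1 hB with h | h | h
  · exact Or.inl (CharTwo.add_eq_zero.1 h)
  · exact Or.inr (Or.inl (CharTwo.add_eq_zero.1 h))
  · have : y = z := add_left_cancel h
    subst this
    rw [add_assoc, add_assoc, ← add_assoc y, CharTwo.add_self_eq_zero, zero_add] at h1
    exact Or.inr (Or.inr (CharTwo.add_eq_zero.1 h1))

-- With `v = u * w` the form is `u ^ (2 ^ k + 1) * (w ^ 2 ^ k + w)`; each `w` other than 0 and 1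
-- then determines exactly one `u`.
open Finset Classical in
theorem card_polar_eq [Fintype F] [CharP F 2] {k : ℕ}
    (hfix : ∀ x : F, x ^ 2 ^ k = x ↔ x = 0 ∨ x = 1)
    (hinj : Function.Injective fun x : F => x ^ (2 ^ k + 1)) {c : F} (hc : c ≠ 0) :
    #{p : F × F | p.1 ^ 2 ^ k * p.2 + p.1 * p.2 ^ 2 ^ k = c} = Fintype.card F - 2 := by
  have hsurj := Finite.surjective_of_injective hinj
  have hcard : #(univ \ {0, 1} : Finset F) = Fintype.card F - 2 := by
    rw [card_sdiff_of_subset (subset_univ _), card_univ, card_pair zero_ne_one]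
  have key (u w : F) : u ^ 2 ^ k * (u * w) + u * (u * w) ^ 2 ^ k
      = u ^ (2 ^ k + 1) * (w ^ 2 ^ k + w) := by
    rw [mul_pow]; ring
  rw [← hcard]
  refine card_nbij (fun p => p.2 / p.1) ?_ ?_ ?_
  · rintro ⟨u, v⟩ h
    simp only [coe_filter, mem_univ, true_and, Set.mem_ofPred_eq] at h
    simp only [coe_sdiff, coe_univ, coe_insert, coe_singleton, Set.mem_sdiff, Set.mem_univ,
      true_and, Set.mem_insert_iff, Set.mem_singleton_iff]
    have hne : ¬(u = 0 ∨ v = 0 ∨ u = v) := fun h' => by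
      rw [(polar_eq_zero_iff hfix).2 h'] at h
      exact hc h.symm
    push Not at hne
    rintro (h' | h')
    · rcases div_eq_zero_iff.1 h' with h' | h'
      exacts [hne.2.1 h', hne.1 h']
    · exact hne.2.2 ((div_eq_one_iff_eq hne.1).1 h').symm
  · rintro ⟨u, v⟩ h ⟨u', v'⟩ h' he
    simp only [coe_filter, mem_univ, true_and, Set.mem_ofPred_eq] at h h' he
    have hu : u ≠ 0 := by rintro rfl; simp at h; exact hc h.symm
    have hu' : u' ≠ 0 := by rintro rfl; simp at h'; exact hc h'.symm
    obtain ⟨w, rfl⟩ : ∃ w, v = u * w := ⟨v / u, by field_simp⟩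
    obtain ⟨w', rfl⟩ : ∃ w, v' = u' * w := ⟨v' / u', by field_simp⟩
    rw [mul_div_cancel_left₀ _ hu, mul_div_cancel_left₀ _ hu'] at he
    subst he
    rw [key] at h h'
    have hw : w ^ 2 ^ k + w ≠ 0 := fun h0 => hc (by rw [← h, h0, mul_zero])
    have : u = u' := hinj (mul_right_cancel₀ hw (h.trans h'.symm))
    rw [this]
  · intro w hw
    simp only [coe_sdiff, coe_univ, coe_insert, coe_singleton, Set.mem_sdiff, Set.mem_univ,
      true_and, Set.mem_insert_iff, Set.mem_singleton_iff] at hw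
    have hw0 : w ^ 2 ^ k + w ≠ 0 := fun h => hw ((hfix w).1 (CharTwo.add_eq_zero.1 h))
    obtain ⟨u, hu⟩ := hsurj (c / (w ^ 2 ^ k + w))
    simp only at hu
    have hu0 : u ≠ 0 := by
      rintro rfl
      rw [zero_pow (by positivity)] at hu
      exact div_ne_zero hc hw0 hu.symm
    refine ⟨(u, u * w), ?_, mul_div_cancel_left₀ _ hu0⟩
    simp only [coe_filter, mem_univ, true_and, Set.mem_ofPred_eq]
    rw [key, hu, div_mul_cancel₀ _ hw0]

-- Translating by `s` writes the triple as `(u + s, v + s, u + v + s)`, and the second equation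
-- becomes: polar form at `(u, v)` equals `t + s ^ (2 ^ k + 1)`.
open Finset Classical in
theorem card_triples_power_sums_eq [Fintype F] [CharP F 2] {k : ℕ}
    (hfix : ∀ x : F, x ^ 2 ^ k = x ↔ x = 0 ∨ x = 1)
    (hinj : Function.Injective fun x : F => x ^ (2 ^ k + 1)) {s t : F}
    (hst : t ≠ s ^ (2 ^ k + 1)) :
    #{p : F × F × F | p.1 + p.2.1 + p.2.2 = s ∧
      p.1 ^ (2 ^ k + 1) + p.2.1 ^ (2 ^ k + 1) + p.2.2 ^ (2 ^ k + 1) = t} =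
      Fintype.card F - 2 := by
  have hc : t + s ^ (2 ^ k + 1) ≠ 0 := fun h => hst (CharTwo.add_eq_zero.1 h)
  rw [← card_polar_eq hfix hinj hc]
  have two := CharTwo.two_eq_zero (R := F)
  have key (s u v : F) : (u + s) ^ (2 ^ k + 1) + (v + s) ^ (2 ^ k + 1) +
      (u + v + s) ^ (2 ^ k + 1) = u ^ 2 ^ k * v + u * v ^ 2 ^ k + s ^ (2 ^ k + 1) := by
    simp only [pow_succ, add_pow_char_pow]
    linear_combination (u ^ 2 ^ k * u + v ^ 2 ^ k * v + u ^ 2 ^ k * s + s ^ 2 ^ k * u +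
      v ^ 2 ^ k * s + s ^ 2 ^ k * v + s ^ 2 ^ k * s) * two
  refine card_nbij' (fun p => (p.1 + s, p.2.1 + s)) (fun p => (p.1 + s, p.2 + s, p.1 + p.2 + s))
    ?_ ?_ ?_ ?_
  · rintro ⟨x, y, z⟩ h
    simp only [coe_filter, mem_univ, true_and, Set.mem_ofPred_eq] at h ⊢
    obtain ⟨h1, h2⟩ := h
    have hz : z = x + s + (y + s) + s := by linear_combination h1 - (x + y + s) * two
    have h3 := key s (x + s) (y + s)
    rw [← hz, CharTwo.add_cancel_right, CharTwo.add_cancel_right, h2] at h3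
    rw [h3, CharTwo.add_cancel_right]
  · rintro ⟨u, v⟩ h
    simp only [coe_filter, mem_univ, true_and, Set.mem_ofPred_eq] at h ⊢
    refine ⟨by linear_combination (u + v + s) * two, ?_⟩
    rw [key, h, CharTwo.add_cancel_right]
  · rintro ⟨x, y, z⟩ h
    simp only [coe_filter, mem_univ, true_and, Set.mem_ofPred_eq] at h
    simp only [Prod.mk.injEq, CharTwo.add_cancel_right, true_and]
    linear_combination -h.1 + (x + y + s) * two
  · rintro ⟨u, v⟩ h
    simp only [CharTwo.add_cancel_right]

end ZeroSum

/-! ### Counting zero-sum sets. -/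

section Counting

open Finset Classical

theorem card_permutations_of_three {α : Type*} {a b c : α} (hab : a ≠ b) (hac : a ≠ c)
    (hbc : b ≠ c) :
    #({(a, b, c), (a, c, b), (b, a, c), (b, c, a), (c, a, b), (c, b, a)} : Finset (α × α × α)) =
      6 := by
  simp [card_insert_of_notMem, hab, hac, hbc, hab.symm, hac.symm, hbc.symm]

theorem mem_permutations_of_three_iff {α : Type*} {a b c x y z : α} (hab : a ≠ b) (hac : a ≠ c)
    (hbc : b ≠ c) :
    (x, y, z) ∈ ({(a, b, c), (a, c, b), (b, a, c), (b, c, a), (c, a, b), (c, b, a)} :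
      Finset (α × α × α)) ↔ ({x, y, z} : Finset α) = {a, b, c} := by
  simp only [mem_insert, mem_singleton, Prod.mk.injEq]
  refine ⟨?_, fun h => ?_⟩
  · rintro (h | h | h | h | h | h) <;> obtain ⟨rfl, rfl, rfl⟩ := h <;> ext <;> simp <;> tauto
  · have h' := fun w => Finset.ext_iff.1 h w
    simp only [mem_insert, mem_singleton] at h'
    have := h' x
    have := h' y
    have := h' z
    have := h' a
    have := h' b
    have := h' c
    grind

section Triples

variable {F : Type*} [Field F] [CharP F 2] {k : ℕ} {a b c x y z : F}

theorem power_sum_three_ne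
    (hfix : ∀ x : F, x ^ 2 ^ k = x ↔ x = 0 ∨ x = 1) (hab : a ≠ b) (hac : a ≠ c) (hbc : b ≠ c) :
    a ^ (2 ^ k + 1) + b ^ (2 ^ k + 1) + c ^ (2 ^ k + 1) ≠ (a + b + c) ^ (2 ^ k + 1) := by
  intro h
  rcases eq_of_two_power_sums_eq hfix (CharTwo.add_eq_zero.2 (rfl : a + b + c = a + b + c))
    (CharTwo.add_eq_zero.2 h) with h | h | h
  · exact hab h
  · exact hac h
  · refine hbc (CharTwo.add_eq_zero.1 ?_)
    linear_combination -h

theorem pair_eq_of_power_sums_eq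
    (hfix : ∀ x : F, x ^ 2 ^ k = x ↔ x = 0 ∨ x = 1) (hyz : y ≠ z) (h1 : a + y + z = a + b + c)
    (h2 : a ^ (2 ^ k + 1) + y ^ (2 ^ k + 1) + z ^ (2 ^ k + 1) =
      a ^ (2 ^ k + 1) + b ^ (2 ^ k + 1) + c ^ (2 ^ k + 1)) :
    (y = b ∧ z = c) ∨ (y = c ∧ z = b) := by
  have two := CharTwo.two_eq_zero (R := F)
  rcases eq_of_two_power_sums_eq hfix (x := y) (y := z) (z := b) (w := c)
    (by linear_combination h1 + (b + c) * two)
    (by linear_combination h2 + (b ^ (2 ^ k + 1) + c ^ (2 ^ k + 1)) * two) with h | h | h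
  · exact absurd h hyz
  · exact Or.inl ⟨h, by linear_combination h1 - h⟩
  · exact Or.inr ⟨h, by linear_combination h1 - h⟩

/-- If `x = y`, both sums collapse to those of `z` alone, against `power_sum_three_ne`. -/
theorem ne_of_power_sums_eq
    (hfix : ∀ x : F, x ^ 2 ^ k = x ↔ x = 0 ∨ x = 1) (hab : a ≠ b) (hac : a ≠ c) (hbc : b ≠ c)
    (h1 : x + y + z = a + b + c)
    (h2 : x ^ (2 ^ k + 1) + y ^ (2 ^ k + 1) + z ^ (2 ^ k + 1) =
      a ^ (2 ^ k + 1) + b ^ (2 ^ k + 1) + c ^ (2 ^ k + 1)) : x ≠ y := by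
  rintro rfl
  rw [CharTwo.add_self_eq_zero, zero_add] at h1 h2
  exact power_sum_three_ne hfix hab hac hbc (by rw [← h2, h1])

theorem three_ne_of_power_sums_eq
    (hfix : ∀ x : F, x ^ 2 ^ k = x ↔ x = 0 ∨ x = 1) (hab : a ≠ b) (hac : a ≠ c) (hbc : b ≠ c)
    (h1 : x + y + z = a + b + c)
    (h2 : x ^ (2 ^ k + 1) + y ^ (2 ^ k + 1) + z ^ (2 ^ k + 1) =
      a ^ (2 ^ k + 1) + b ^ (2 ^ k + 1) + c ^ (2 ^ k + 1)) : x ≠ y ∧ x ≠ z ∧ y ≠ z :=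
  ⟨ne_of_power_sums_eq hfix hab hac hbc h1 h2,
    ne_of_power_sums_eq hfix hab hac hbc (z := y) (by rw [← h1]; ring) (by rw [← h2]; ring),
    ne_of_power_sums_eq hfix hab hac hbc (z := x) (by rw [← h1]; ring) (by rw [← h2]; ring)⟩

theorem permutation_of_power_sums_eq
    (hfix : ∀ x : F, x ^ 2 ^ k = x ↔ x = 0 ∨ x = 1) (hab : a ≠ b) (hac : a ≠ c) (hbc : b ≠ c)
    (h1 : x + y + z = a + b + c)
    (h2 : x ^ (2 ^ k + 1) + y ^ (2 ^ k + 1) + z ^ (2 ^ k + 1) =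
      a ^ (2 ^ k + 1) + b ^ (2 ^ k + 1) + c ^ (2 ^ k + 1))
    (hx : x = a ∨ x = b ∨ x = c) : ({x, y, z} : Finset F) = {a, b, c} := by
  obtain ⟨-, -, hyz⟩ := three_ne_of_power_sums_eq hfix hab hac hbc h1 h2
  rcases hx with rfl | rfl | rfl
  · rcases pair_eq_of_power_sums_eq hfix hyz h1 h2 with ⟨rfl, rfl⟩ | ⟨rfl, rfl⟩
    · rfl
    · ext; simp; tauto
  · rcases pair_eq_of_power_sums_eq hfix (b := a) (c := c) hyz (h1.trans (by ring))
      (h2.trans (by ring)) with ⟨rfl, rfl⟩ | ⟨rfl, rfl⟩ <;> ext <;> simp <;> tauto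
  · rcases pair_eq_of_power_sums_eq hfix (b := a) (c := b) hyz (h1.trans (by ring))
      (h2.trans (by ring)) with ⟨rfl, rfl⟩ | ⟨rfl, rfl⟩ <;> ext <;> simp <;> tauto

end Triples

variable {F : Type*} [Field F] [Fintype F]

/-- The `w`-element sets `S` with `∑ x = 0` and `∑ x ^ (2 ^ k + 1) = 0` over `x ∈ S`. -/
noncomputable def zeroSumSets (F : Type*) [Field F] [Fintype F] (k w : ℕ) : Finset (Finset F) :=
  {S ∈ powersetCard w univ | ∑ x ∈ S, x = 0 ∧ ∑ x ∈ S, x ^ (2 ^ k + 1) = 0}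

theorem mem_zeroSumSets {k w : ℕ} {S : Finset F} :
    S ∈ zeroSumSets F k w ↔ #S = w ∧ ∑ x ∈ S, x = 0 ∧ ∑ x ∈ S, x ^ (2 ^ k + 1) = 0 := by
  simp [zeroSumSets, mem_powersetCard]

theorem insert_zero_mem_zeroSumSets {k w : ℕ} {S : Finset F} (h0 : (0 : F) ∉ S) :
    insert 0 S ∈ zeroSumSets F k (w + 1) ↔ S ∈ zeroSumSets F k w := by
  simp [mem_zeroSumSets, card_insert_of_notMem h0, sum_insert h0]

theorem card_zeroSumSets_zero_mem (k w : ℕ) :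
    #{S ∈ zeroSumSets F k (w + 1) | 0 ∈ S} = #{S ∈ zeroSumSets F k w | 0 ∉ S} := by
  refine card_nbij' (fun S => S.erase 0) (fun S => insert 0 S) ?_ ?_ ?_ ?_
  · intro S hS
    rw [mem_coe, mem_filter] at hS ⊢
    refine ⟨?_, notMem_erase _ _⟩
    rw [← insert_zero_mem_zeroSumSets (notMem_erase _ _), insert_erase hS.2]
    exact hS.1
  · intro S hS
    rw [mem_coe, mem_filter] at hS ⊢
    exact ⟨(insert_zero_mem_zeroSumSets hS.2).2 hS.1, mem_insert_self _ _⟩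
  · intro S hS
    rw [mem_coe, mem_filter] at hS
    exact insert_erase hS.2
  · intro S hS
    rw [mem_coe, mem_filter] at hS
    exact erase_insert hS.2

variable [CharP F 2] {k : ℕ}

theorem zeroSumSets_four (hfix : ∀ x : F, x ^ 2 ^ k = x ↔ x = 0 ∨ x = 1) :
    zeroSumSets F k 4 = ∅ := by
  refine eq_empty_of_forall_notMem fun S hS => ?_
  obtain ⟨hc, h1, h2⟩ := mem_zeroSumSets.1 hS
  obtain ⟨x, T, hx, rfl, hT⟩ := card_eq_succ.1 hc
  obtain ⟨y, z, w, hyz, hyw, hzw, rfl⟩ := card_eq_three.1 hT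
  rw [sum_insert hx, sum_insert (by simp [hyz, hyw]), sum_pair hzw] at h1 h2
  have := eq_of_two_power_sums_eq hfix (x := x) (y := y) (z := z) (w := w)
    (by rw [← h1]; ring) (by rw [← h2]; ring)
  simp only [mem_insert, mem_singleton] at hx
  exact hx this

/-- One element shared with `{a, b, c}` forces the other two, so exactly the six orderings are
removed from the `q - 2` triples. -/
theorem card_disjoint_triples (hfix : ∀ x : F, x ^ 2 ^ k = x ↔ x = 0 ∨ x = 1)
    (hinj : Function.Injective fun x : F => x ^ (2 ^ k + 1)) {a b c : F}
    (hab : a ≠ b) (hac : a ≠ c) (hbc : b ≠ c) :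
    #{p : F × F × F | (p.1 + p.2.1 + p.2.2 = a + b + c ∧
      p.1 ^ (2 ^ k + 1) + p.2.1 ^ (2 ^ k + 1) + p.2.2 ^ (2 ^ k + 1) =
        a ^ (2 ^ k + 1) + b ^ (2 ^ k + 1) + c ^ (2 ^ k + 1)) ∧
      Disjoint {p.1, p.2.1, p.2.2} ({a, b, c} : Finset F)} = Fintype.card F - 8 := by
  have key := card_triples_power_sums_eq hfix hinj (power_sum_three_ne hfix hab hac hbc)
  rw [← card_filter_add_card_filter_not
    (fun p : F × F × F => Disjoint {p.1, p.2.1, p.2.2} ({a, b, c} : Finset F)),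
    filter_filter, filter_filter] at key
  suffices h : ({p : F × F × F | (p.1 + p.2.1 + p.2.2 = a + b + c ∧
      p.1 ^ (2 ^ k + 1) + p.2.1 ^ (2 ^ k + 1) + p.2.2 ^ (2 ^ k + 1) =
        a ^ (2 ^ k + 1) + b ^ (2 ^ k + 1) + c ^ (2 ^ k + 1)) ∧
      ¬Disjoint {p.1, p.2.1, p.2.2} ({a, b, c} : Finset F)} : Finset (F × F × F)) =
      {(a, b, c), (a, c, b), (b, a, c), (b, c, a), (c, a, b), (c, b, a)} by
    rw [h, card_permutations_of_three hab hac hbc] at key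
    omega
  symm
  ext ⟨x, y, z⟩
  rw [mem_permutations_of_three_iff hab hac hbc, mem_filter_univ]
  refine ⟨fun h => ⟨⟨?_, ?_⟩, ?_⟩, fun ⟨⟨h1, h2⟩, h⟩ => ?_⟩
  · rw [← mem_permutations_of_three_iff hab hac hbc] at h
    simp only [mem_insert, mem_singleton, Prod.mk.injEq] at h
    rcases h with h | h | h | h | h | h <;> obtain ⟨rfl, rfl, rfl⟩ := h <;> ring
  · rw [← mem_permutations_of_three_iff hab hac hbc] at h
    simp only [mem_insert, mem_singleton, Prod.mk.injEq] at h
    rcases h with h | h | h | h | h | h <;> obtain ⟨rfl, rfl, rfl⟩ := h <;> ring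
  · rw [h, disjoint_self_iff_empty]
    exact insert_ne_empty _ _
  · obtain ⟨w, hw, hw'⟩ := not_disjoint_iff.1 h
    simp only [mem_insert, mem_singleton] at hw hw'
    rcases hw with rfl | rfl | rfl
    · exact permutation_of_power_sums_eq hfix hab hac hbc h1 h2 hw'
    · rw [← permutation_of_power_sums_eq hfix hab hac hbc (y := x) (z := z)
        (by rw [← h1]; ring) (by rw [← h2]; ring) hw']
      ext; simp; tauto
    · rw [← permutation_of_power_sums_eq hfix hab hac hbc (y := x) (z := y)
        (by rw [← h1]; ring) (by rw [← h2]; ring) hw']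
      ext; simp; tauto

theorem six_mul_card_zeroSumSets_six_superset
    (hfix : ∀ x : F, x ^ 2 ^ k = x ↔ x = 0 ∨ x = 1)
    (hinj : Function.Injective fun x : F => x ^ (2 ^ k + 1)) {T : Finset F} (hT : #T = 3) :
    6 * #{S ∈ zeroSumSets F k 6 | T ⊆ S} = Fintype.card F - 8 := by
  obtain ⟨a, b, c, hab, hac, hbc, rfl⟩ := card_eq_three.1 hT
  rw [← card_disjoint_triples hfix hinj hab hac hbc, mul_comm]
  have sum_three (g : F → F) {x y z : F} (hxy : x ≠ y) (hxz : x ≠ z) (hyz : y ≠ z) :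
      ∑ w ∈ {x, y, z}, g w = g x + g y + g z := by
    rw [sum_insert (by simp [hxy, hxz]), sum_pair hyz, add_assoc]
  -- The fibre over a 6-set `S` consists of the six orderings of `S \ {a, b, c}`.
  rw [card_eq_sum_card_fiberwise (f := fun p : F × F × F => {p.1, p.2.1, p.2.2} ∪ {a, b, c})
    (t := {S ∈ zeroSumSets F k 6 | {a, b, c} ⊆ S}), sum_const_nat]
  · intro S hS
    rw [mem_filter, mem_zeroSumSets] at hS
    obtain ⟨⟨hcard, h1, h2⟩, hTS⟩ := hS
    have hdiff : #(S \ {a, b, c}) = 3 := by rw [card_sdiff_of_subset hTS, hcard, hT]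
    obtain ⟨x, y, z, hxy, hxz, hyz, hS⟩ := card_eq_three.1 hdiff
    rw [← sum_sdiff hTS, hS, sum_three _ hxy hxz hyz, sum_three _ hab hac hbc,
      CharTwo.add_eq_zero] at h1 h2
    rw [← card_permutations_of_three hxy hxz hyz]
    congr 1
    ext ⟨x', y', z'⟩
    rw [mem_permutations_of_three_iff hxy hxz hyz, ← hS, mem_filter, mem_filter_univ]
    refine ⟨fun ⟨⟨_, hd⟩, h⟩ => ?_, fun h => ⟨⟨?_, ?_⟩, ?_⟩⟩
    · rw [← h, union_sdiff_cancel_right hd]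
    · rw [hS, ← mem_permutations_of_three_iff hxy hxz hyz] at h
      simp only [mem_insert, mem_singleton, Prod.mk.injEq] at h
      rw [← h1, ← h2]
      rcases h with h | h | h | h | h | h <;> obtain ⟨rfl, rfl, rfl⟩ := h <;>
        exact ⟨by ring, by ring⟩
    · simp only [h]
      exact sdiff_disjoint
    · simp only [h]
      exact sdiff_union_of_subset hTS
  · rintro ⟨x, y, z⟩ h
    rw [mem_coe, mem_filter_univ] at h
    obtain ⟨⟨h1, h2⟩, hd⟩ := h
    obtain ⟨hxy, hxz, hyz⟩ := three_ne_of_power_sums_eq hfix hab hac hbc h1 h2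
    rw [mem_coe, mem_filter, mem_zeroSumSets]
    refine ⟨⟨?_, ?_, ?_⟩, subset_union_right⟩
    · rw [card_union_of_disjoint hd, hT, card_eq_three.2 ⟨x, y, z, hxy, hxz, hyz, rfl⟩]
    · rw [sum_union hd, sum_three _ hxy hxz hyz, sum_three _ hab hac hbc]
      exact CharTwo.add_eq_zero.2 h1
    · rw [sum_union hd, sum_three _ hxy hxz hyz, sum_three _ hab hac hbc]
      exact CharTwo.add_eq_zero.2 h2

theorem card_zeroSumSets_six_mul (hfix : ∀ x : F, x ^ 2 ^ k = x ↔ x = 0 ∨ x = 1)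
    (hinj : Function.Injective fun x : F => x ^ (2 ^ k + 1)) :
    120 * #(zeroSumSets F k 6) = (Fintype.card F).choose 3 * (Fintype.card F - 8) := by
  have h := sum_card_bipartiteAbove_eq_sum_card_bipartiteBelow (fun S T : Finset F => T ⊆ S)
    (s := zeroSumSets F k 6) (t := powersetCard 3 univ)
  -- Each 6-set has `choose 6 3 = 20` three-element subsets.
  have h20 : ∑ S ∈ zeroSumSets F k 6, #(bipartiteAbove (fun S T : Finset F => T ⊆ S)
      (powersetCard 3 univ) S) = #(zeroSumSets F k 6) * 20 := by
    refine sum_const_nat fun S hS => ?_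
    have : bipartiteAbove (fun S T : Finset F => T ⊆ S) (powersetCard 3 univ) S =
        powersetCard 3 S := by
      ext T
      simp [bipartiteAbove, mem_powersetCard, and_comm]
    rw [this, card_powersetCard, (mem_zeroSumSets.1 hS).1]
    rfl
  rw [show 120 = 6 * 20 from rfl, mul_assoc, mul_comm 20, ← h20, h, mul_sum, ← card_univ,
    ← card_powersetCard, card_univ]
  refine sum_const_nat fun T hT => ?_
  exact six_mul_card_zeroSumSets_six_superset hfix hinj (mem_powersetCard.1 hT).2

/-- Evenness of `w` kills the constant terms; the cross terms vanish because `∑ x ^ 2 ^ k = (∑ x) ^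
2 ^ k = 0`. -/
theorem image_add_mem_zeroSumSets {w : ℕ} (hw : Even w) (a : F) {S : Finset F}
    (hS : S ∈ zeroSumSets F k w) : S.image (a + ·) ∈ zeroSumSets F k w := by
  rw [mem_zeroSumSets] at hS ⊢
  obtain ⟨hc, h1, h2⟩ := hS
  have h0 : (w : F) = 0 := by
    rw [CharTwo.natCast_eq_ite, if_pos hw]
  have h3 : ∑ x ∈ S, x ^ 2 ^ k = 0 := by
    rw [← sum_pow_char_pow, h1, zero_pow (by positivity)]
  refine ⟨by rw [card_image_of_injective _ (add_right_injective a), hc], ?_, ?_⟩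
  · rw [sum_image (add_right_injective a).injOn, sum_add_distrib, h1, sum_const, hc, nsmul_eq_mul,
      h0]
    simp
  · rw [sum_image (add_right_injective a).injOn]
    simp_rw [add_pow_two_pow_add_one]
    rw [sum_add_distrib, sum_add_distrib, sum_add_distrib, ← mul_sum, ← mul_sum, h1, h2, h3,
      sum_const, hc, nsmul_eq_mul, h0]
    simp

theorem card_zeroSumSets_mem {w : ℕ} (hw : Even w) (a : F) :
    #{S ∈ zeroSumSets F k w | a ∈ S} = #{S ∈ zeroSumSets F k w | 0 ∈ S} := by
  have hinv : ∀ S : Finset F, (S.image (a + ·)).image (a + ·) = S := fun S => by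
    simp only [image_image, Function.comp_def, CharTwo.add_cancel_left, image_id']
  refine card_nbij' (fun S => S.image (a + ·)) (fun S => S.image (a + ·)) ?_ ?_
    (fun S _ => hinv S) (fun S _ => hinv S)
  · intro S hS
    rw [mem_coe, mem_filter] at hS ⊢
    exact ⟨image_add_mem_zeroSumSets hw a hS.1,
      mem_image.2 ⟨a, hS.2, CharTwo.add_self_eq_zero a⟩⟩
  · intro S hS
    rw [mem_coe, mem_filter] at hS ⊢
    exact ⟨image_add_mem_zeroSumSets hw a hS.1, mem_image.2 ⟨0, hS.2, add_zero a⟩⟩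

theorem mul_card_zeroSumSets {w : ℕ} (hw : Even w) :
    w * #(zeroSumSets F k w) = Fintype.card F * #{S ∈ zeroSumSets F k w | 0 ∈ S} := by
  have h := sum_card_bipartiteAbove_eq_sum_card_bipartiteBelow (fun (S : Finset F) x => x ∈ S)
    (s := zeroSumSets F k w) (t := univ)
  have h1 : ∀ S ∈ zeroSumSets F k w,
      #(bipartiteAbove (fun (S : Finset F) x => x ∈ S) univ S) = w := by
    intro S hS
    rw [← (mem_zeroSumSets.1 hS).1, bipartiteAbove, filter_univ_mem]
  rw [sum_const_nat h1] at h
  rw [mul_comm, h, ← card_univ]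
  exact sum_const_nat fun x _ => card_zeroSumSets_mem hw x

theorem card_zeroSumSets_notMem (hfix : ∀ x : F, x ^ 2 ^ k = x ↔ x = 0 ∨ x = 1)
    (hinj : Function.Injective fun x : F => x ^ (2 ^ k + 1)) (h8 : 8 ≤ Fintype.card F) :
    #{S ∈ zeroSumSets F k 3 | 0 ∉ S} = 0 ∧ #{S ∈ zeroSumSets F k 4 | 0 ∉ S} = 0 ∧
    (#{S ∈ zeroSumSets F k 5 | 0 ∉ S} : ℚ) = ((Fintype.card F : ℚ) - 1) *
      ((Fintype.card F : ℚ) - 2) * ((Fintype.card F : ℚ) - 8) / 120 ∧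
    (#{S ∈ zeroSumSets F k 6 | 0 ∉ S} : ℚ) = ((Fintype.card F : ℚ) - 1) *
      ((Fintype.card F : ℚ) - 2) * ((Fintype.card F : ℚ) - 6) *
      ((Fintype.card F : ℚ) - 8) / 720 := by
  have e6 := card_zeroSumSets_six_mul hfix hinj
  have e5 := mul_card_zeroSumSets (F := F) (k := k) (w := 6) (by decide)
  have split := card_filter_add_card_filter_not (s := zeroSumSets F k 6) (fun S => (0 : F) ∈ S)
  rw [card_zeroSumSets_zero_mem] at e5 split
  have hq0 : (Fintype.card F : ℚ) ≠ 0 := by positivity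
  have hch : ((Fintype.card F).choose 3 : ℚ) = (Fintype.card F : ℚ) *
      ((Fintype.card F : ℚ) - 1) * ((Fintype.card F : ℚ) - 2) / 6 := by
    rw [Nat.cast_choose_eq_descPochhammer_div]
    simp [descPochhammer_succ_right, Nat.factorial]
  have e6' : 120 * (#(zeroSumSets F k 6) : ℚ) = (Fintype.card F : ℚ) *
      ((Fintype.card F : ℚ) - 1) * ((Fintype.card F : ℚ) - 2) / 6 *
        ((Fintype.card F : ℚ) - 8) := by
    have := congrArg (Nat.cast (R := ℚ)) e6
    -- The bound `h8` makes the truncated subtraction `q - 8` a genuine one in `ℚ`.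
    push_cast [h8] at this
    rw [← hch, this]
  have e5' : 6 * (#(zeroSumSets F k 6) : ℚ) =
      Fintype.card F * #{S ∈ zeroSumSets F k 5 | 0 ∉ S} := by exact_mod_cast e5
  have split' : (#{S ∈ zeroSumSets F k 5 | 0 ∉ S} : ℚ) + #{S ∈ zeroSumSets F k 6 | 0 ∉ S} =
      #(zeroSumSets F k 6) := by exact_mod_cast split
  have a5 : (#{S ∈ zeroSumSets F k 5 | 0 ∉ S} : ℚ) = ((Fintype.card F : ℚ) - 1) *
      ((Fintype.card F : ℚ) - 2) * ((Fintype.card F : ℚ) - 8) / 120 := by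
    refine mul_left_cancel₀ hq0 ?_
    linear_combination -e5' + e6' / 20
  refine ⟨?_, ?_, a5, ?_⟩
  · rw [← card_zeroSumSets_zero_mem, zeroSumSets_four hfix]
    rfl
  · rw [zeroSumSets_four hfix]
    rfl
  · linear_combination split' + e6' / 120 - a5

end Counting

/-! ### From codewords to zero-sum sets. -/

section Codewords

theorem mem_ofGenerator_iff {K : Type*} [Field K] {n : ℕ} {g : K[X]} (hg : g ∣ X ^ n - 1)
    {c : Fin n → K} : c ∈ ofGenerator n g ↔ g ∣ wordPoly K n c := by
  have h : c ∈ ofGenerator n g ↔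
      Ideal.Quotient.mk (Ideal.span {(X ^ n - 1 : K[X])}) (wordPoly K n c) ∈
        Ideal.span {Ideal.Quotient.mk (Ideal.span {(X ^ n - 1 : K[X])}) g} := Iff.rfl
  rw [h, Ideal.mem_span_singleton]
  refine ⟨fun ⟨u, hu⟩ => ?_, map_dvd _⟩
  obtain ⟨v, rfl⟩ := Ideal.Quotient.mk_surjective u
  rw [← map_mul, Ideal.Quotient.eq, Ideal.mem_span_singleton] at hu
  exact (dvd_sub_left (dvd_mul_right g v)).1 (hg.trans hu)

theorem aeval_wordPoly {K A : Type*} [Field K] [CommRing A] [Algebra K A] {n : ℕ} (a : A)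
    (c : Fin n → K) : aeval a (wordPoly K n c) = ∑ i, algebraMap K A (c i) * a ^ (i : ℕ) := by
  simp [wordPoly, aeval_monomial]

variable {F : Type*} [Field F] [Finite F] [Algebra (ZMod 2) F]

/-- Were they equal, an automorphism would send the generator `γ` to its `(2 ^ k + 1)`-th power and
so be `x ↦ x ^ (2 ^ k + 1)`. Additivity at `(x, 1)` gives `x ^ 2 ^ k = x` for all `x`, hence `F =
{0, 1}`. -/
theorem minpoly_pow_two_pow_add_one_ne {k : ℕ}
    (hfix : ∀ x : F, x ^ 2 ^ k = x ↔ x = 0 ∨ x = 1) (hcard : 2 < Nat.card F) {γ : Fˣ}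
    (hγ : ∀ x : Fˣ, x ∈ Subgroup.zpowers γ) :
    minpoly (ZMod 2) (γ : F) ≠ minpoly (ZMod 2) ((γ : F) ^ (2 ^ k + 1)) := by
  have : CharP F 2 := charP_of_injective_algebraMap (algebraMap (ZMod 2) F).injective 2
  intro h
  obtain ⟨σ, hσ⟩ := isConjRoot_iff_exists_algEquiv.1 (isConjRoot_def.2 h.symm)
  have hpow (x : F) : σ x = x ^ (2 ^ k + 1) := by
    by_cases hx : x = 0
    · simp [hx]
    · obtain ⟨j, hj⟩ := hγ (Units.mk0 x hx)
      have hx' : x = (γ : F) ^ j := by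
        rw [← Units.val_zpow_eq_zpow_val]
        simpa using (congrArg Units.val hj).symm
      rw [hx', map_zpow₀, hσ, ← zpow_natCast, ← zpow_natCast, ← zpow_mul, ← zpow_mul, mul_comm]
  have hall (x : F) : x = 0 ∨ x = 1 := by
    have h1 := map_add σ x 1
    rw [hpow, hpow, hpow, add_pow_two_pow_add_one] at h1
    have h2 : x ^ 2 ^ k + x = 0 := by simpa using h1
    exact (hfix x).1 (CharTwo.add_eq_zero.1 h2)
  have hle : Nat.card F ≤ 2 := by
    have huniv : (Set.univ : Set F) ⊆ {0, 1} := fun x _ => by simpa using hall x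
    rw [← Set.ncard_univ, ← Set.ncard_pair (zero_ne_one (α := F))]
    exact Set.ncard_le_ncard huniv
  omega

theorem mem_code_iff {k : ℕ} (hfix : ∀ x : F, x ^ 2 ^ k = x ↔ x = 0 ∨ x = 1)
    (hcard : 2 < Nat.card F) {γ : Fˣ} (hγ : ∀ x : Fˣ, x ∈ Subgroup.zpowers γ)
    {c : Fin (Nat.card F - 1) → ZMod 2} :
    c ∈ code 2 (γ : F) ![1, 2 ^ k + 1] ↔
      ∑ i, algebraMap (ZMod 2) F (c i) * (γ : F) ^ (i : ℕ) = 0 ∧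
      ∑ i, algebraMap (ZMod 2) F (c i) * ((γ : F) ^ (2 ^ k + 1)) ^ (i : ℕ) = 0 := by
  have hprod : (∏ j, minpoly (ZMod 2) ((γ : F) ^ (![1, 2 ^ k + 1] : Fin 2 → ℕ) j)) =
      minpoly (ZMod 2) (γ : F) * minpoly (ZMod 2) ((γ : F) ^ (2 ^ k + 1)) := by
    simp [Fin.prod_univ_two]
  have hint (x : F) : IsIntegral (ZMod 2) x := Algebra.IsIntegral.isIntegral x
  -- Coprimality of the two factors lets divisibility by their product be tested at the two roots
  -- separately.
  have hcop : IsCoprime (minpoly (ZMod 2) (γ : F))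
      (minpoly (ZMod 2) ((γ : F) ^ (2 ^ k + 1))) := by
    rw [(minpoly.irreducible (hint _)).coprime_iff_not_dvd]
    intro hdvd
    refine minpoly_pow_two_pow_add_one_ne hfix hcard hγ ?_
    exact eq_of_monic_of_associated (minpoly.monic (hint _)) (minpoly.monic (hint _))
      ((minpoly.irreducible (hint _)).associated_of_dvd (minpoly.irreducible (hint _)) hdvd)
  have hdvd (P : (ZMod 2)[X]) : minpoly (ZMod 2) (γ : F) *
      minpoly (ZMod 2) ((γ : F) ^ (2 ^ k + 1)) ∣ P ↔
      aeval (γ : F) P = 0 ∧ aeval ((γ : F) ^ (2 ^ k + 1)) P = 0 := by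
    rw [← minpoly.dvd_iff, ← minpoly.dvd_iff]
    exact ⟨fun h => ⟨(dvd_mul_right _ _).trans h, (dvd_mul_left _ _).trans h⟩,
      fun h => hcop.mul_dvd h.1 h.2⟩
  have hone (x : Fˣ) : (x : F) ^ (Nat.card F - 1) = 1 := by
    have := Fintype.ofFinite F
    rw [Nat.card_eq_fintype_card]
    exact FiniteField.pow_card_sub_one_eq_one _ x.ne_zero
  rw [code, hprod, mem_ofGenerator_iff, hdvd, aeval_wordPoly, aeval_wordPoly]
  rw [hdvd]
  refine ⟨by simp [hone], ?_⟩
  have := hone (γ ^ (2 ^ k + 1))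
  rw [Units.val_pow_eq_pow_val] at this
  simp [this]

-- A binary word is its support, and `i ↦ γ ^ i` carries supports bijectively to subsets of `F \
-- {0}`.
open Finset Classical in
theorem weightCount_code {F : Type*} [Field F] [Fintype F] [Algebra (ZMod 2) F] {k : ℕ}
    (hfix : ∀ x : F, x ^ 2 ^ k = x ↔ x = 0 ∨ x = 1) (hcard : 2 < Nat.card F) {γ : Fˣ}
    (hγ : ∀ x : Fˣ, x ∈ Subgroup.zpowers γ) (w : ℕ) :
    weightCount (code 2 (γ : F) ![1, 2 ^ k + 1]) w = #{S ∈ zeroSumSets F k w | 0 ∉ S} := by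
  have hbit : ∀ b : ZMod 2, b ≠ 0 → b = 1 := by decide
  have hord : orderOf γ = Nat.card F - 1 := by
    rw [orderOf_eq_card_of_forall_mem_zpowers hγ, Nat.card_units]
  have hpinj : Function.Injective fun i : Fin (Nat.card F - 1) => (γ : F) ^ (i : ℕ) := by
    intro i j hij
    have h : γ ^ (i : ℕ) = γ ^ (j : ℕ) := Units.ext (by simpa using hij)
    exact Fin.ext (pow_injOn_Iio_orderOf (i.2.trans_eq hord.symm) (j.2.trans_eq hord.symm) h)
  have hpsurj (x : F) (hx : x ≠ 0) : ∃ i : Fin (Nat.card F - 1), (γ : F) ^ (i : ℕ) = x := by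
    obtain ⟨j, hj, hj'⟩ := (isOfFinOrder_of_finite γ).mem_zpowers_iff_mem_range_orderOf.1
      (hγ (Units.mk0 x hx)) |> Finset.mem_image.1
    rw [mem_range, hord] at hj
    refine ⟨⟨j, hj⟩, ?_⟩
    simpa using congrArg Units.val hj'
  have hsum (c : Fin (Nat.card F - 1) → ZMod 2) (g : Fin (Nat.card F - 1) → F) :
      ∑ i, algebraMap (ZMod 2) F (c i) * g i = ∑ i with c i ≠ 0, g i := by
    rw [sum_filter]
    refine sum_congr rfl fun i _ => ?_
    split_ifs with h
    · rw [hbit _ h, map_one, one_mul]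
    · simp [not_not.1 h]
  have hmem (c : Fin (Nat.card F - 1) → ZMod 2) :
      (c ∈ code 2 (γ : F) ![1, 2 ^ k + 1] ∧ hammingNorm c = w) ↔
        ({i | c i ≠ 0} : Finset (Fin (Nat.card F - 1))).image
          (fun i : Fin (Nat.card F - 1) => (γ : F) ^ (i : ℕ)) ∈
          zeroSumSets F k w := by
    rw [mem_code_iff hfix hcard hγ, mem_zeroSumSets, card_image_of_injective _ hpinj,
      sum_image hpinj.injOn, sum_image hpinj.injOn, hsum, hsum, and_comm, hammingNorm]
    simp_rw [← pow_mul, mul_comm]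
  rw [weightCount, ← Set.ncard_coe_finset]
  refine Set.ncard_congr (fun c _ => ({i | c i ≠ 0} : Finset _).image
    (fun i : Fin (Nat.card F - 1) => (γ : F) ^ (i : ℕ))) ?_ ?_ ?_
  · intro c hc
    rw [mem_coe, mem_filter]
    refine ⟨(hmem c).1 hc, fun h0 => ?_⟩
    obtain ⟨i, -, hi⟩ := mem_image.1 h0
    exact pow_ne_zero _ γ.ne_zero hi
  · intro c c' _ _ h
    have h' := image_injective hpinj h
    funext i
    have hi : c i ≠ 0 ↔ c' i ≠ 0 := by simpa using Finset.ext_iff.1 h' i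
    by_cases h0 : c i = 0
    · rw [h0, not_not.1 (fun h1 => hi.2 h1 h0)]
    · rw [hbit _ h0, hbit _ (hi.1 h0)]
  · intro S hS
    rw [mem_coe, mem_filter] at hS
    have himg : ({i | (if (γ : F) ^ (i : ℕ) ∈ S then 1 else 0 : ZMod 2) ≠ 0} :
        Finset (Fin (Nat.card F - 1))).image
          (fun i : Fin (Nat.card F - 1) => (γ : F) ^ (i : ℕ)) = S := by
      ext x
      simp only [mem_image, mem_filter_univ, ne_eq, ite_eq_right_iff, one_ne_zero, imp_false,
        not_not]
      refine ⟨fun ⟨i, hi, hx⟩ => hx ▸ hi, fun hx => ?_⟩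
      obtain ⟨i, rfl⟩ := hpsurj x (fun h => hS.2 (h ▸ hx))
      exact ⟨i, hx, rfl⟩
    exact ⟨fun i => if (γ : F) ^ (i : ℕ) ∈ S then 1 else 0,
      (hmem _).2 (himg.symm ▸ hS.1), himg⟩

end Codewords

end CyclicCode

theorem mainTheorem2 (k f q : ℕ) (hk : 0 < k) (hf : 0 < f)
    (hkf : Nat.gcd k (2 * f + 1) = 1) (hq : q = 2 ^ (2 * f + 1))
    {F : Type*} [Field F] [Finite F] [Algebra (ZMod 2) F] (hF : Nat.card F = q)
    (γ : Fˣ) (hγ : ∀ x : Fˣ, x ∈ Subgroup.zpowers γ) :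
    CyclicCode.weightCount (CyclicCode.code 2 (γ : F) ![1, 2 ^ k + 1]) 3 = 0 ∧
    CyclicCode.weightCount (CyclicCode.code 2 (γ : F) ![1, 2 ^ k + 1]) 4 = 0 ∧
    (CyclicCode.weightCount (CyclicCode.code 2 (γ : F) ![1, 2 ^ k + 1]) 5 : ℚ) =
      ((q : ℚ) - 1) * ((q : ℚ) - 2) * ((q : ℚ) - 8) / 120 ∧
    (CyclicCode.weightCount (CyclicCode.code 2 (γ : F) ![1, 2 ^ k + 1]) 6 : ℚ) =
      ((q : ℚ) - 1) * ((q : ℚ) - 2) * ((q : ℚ) - 6) * ((q : ℚ) - 8) / 720 := by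
  have := Fintype.ofFinite F
  have : CharP F 2 := charP_of_injective_algebraMap (algebraMap (ZMod 2) F).injective 2
  have hF' : Nat.card F = 2 ^ (2 * f + 1) := hF.trans hq
  have h8 : 8 ≤ Nat.card F := by
    rw [hF']
    exact Nat.pow_le_pow_right (n := 2) (i := 3) (by norm_num) (by omega)
  have hfix : ∀ x : F, x ^ 2 ^ k = x ↔ x = 0 ∨ x = 1 := fun x =>
    CyclicCode.pow_two_pow_eq_self_iff hF' hkf
  have hinj := CyclicCode.pow_two_pow_add_one_injective hF' hkf (odd_two_mul_add_one f)
  simp only [CyclicCode.weightCount_code hfix (by omega) hγ]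
  rw [Nat.card_eq_fintype_card] at h8 hF
  have h := CyclicCode.card_zeroSumSets_notMem hfix hinj h8
  rwa [hF] at h
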